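/- Let $\Bbbk$ be a field of characteristic zero and let $W_+$ be the positive Witt algebra over $\Bbbk$, that is, the Lie algebra with basis $\{e_n : n \in \mathbb{Z}_{\ge 1}\}$ and bracket $[e_i, e_j] = (j-i)e_{i+j}$. Let $\mathrm{U}(W_+)$ be its universal enveloping algebra, and let $\mathrm{S}^2(W_+)$ be the degree-two part of the symmetric algebra $\mathrm{S}(W_+)$, regarded as a $\mathrm{U}(W_+)$-module through the action of $W_+$ on $\mathrm{S}(W_+)$ by derivations extending the adjoint action. For a module $M$ over a $\Bbbk$-algebra $A$, the Gelfand–Kirillov dimension is $$\operatorname{GKdim} M = \sup_{V, F}\ \limsup_{n \to \infty}\ \log_n \dim_{\Bbbk}\bigl((\Bbbk + V)^n F\bigr),$$ where $V$ and $F$ range over the finite-dimensional subspaces of $A$ and of $M$ (and the zero module is given dimension $0$). The module $M$ is called GK $d$-critical if $\operatorname{GKdim} M = d$ and $\operatorname{GKdim}(M/N) < d$ for every nonzero submodule $N$ of $M$. Then, as a $\mathrm{U}(W_+)$-module, $\mathrm{S}^2(W_+)$ is GK $2$-critical. Moreover, for every nonzero $f \in \mathrm{S}^2(W_+)$, the quotient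 $\mathrm{S}^2(W_+)/\mathrm{U}(W_+)f$ has GK-dimension at most $1$. -/

import Mathlib

noncomputable section

/-! ### The positive Witt algebra -/

/-- The positive Witt algebra `W₊` over `k`: the free `k`-module on `e_n`, `n ≥ 1`. -/
def PositiveWitt (k : Type*) [CommRing k] : Type _ := ℕ+ →₀ k

namespace PositiveWitt

variable (k : Type*) [CommRing k]

instance : AddCommGroup (PositiveWitt k) := inferInstanceAs (AddCommGroup (ℕ+ →₀ k))

instance : Module k (PositiveWitt k) := inferInstanceAs (Module k (ℕ+ →₀ k))

/-- The basis `(e_n)_{n ≥ 1}` of `W₊`. -/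
def e : Module.Basis ℕ+ k (PositiveWitt k) := ⟨LinearEquiv.refl k (ℕ+ →₀ k)⟩

/-- The bilinear map with `(e_i, e_j) ↦ (j - i) e_{i+j}`. -/
def bracket : PositiveWitt k →ₗ[k] PositiveWitt k →ₗ[k] PositiveWitt k :=
  (e k).constr k fun i => (e k).constr k fun j =>
    (((j : ℕ) : k) - ((i : ℕ) : k)) • e k (i + j)

theorem bracket_e (i j : ℕ+) :
    bracket k (e k i) (e k j) = (((j : ℕ) : k) - ((i : ℕ) : k)) • e k (i + j) := by
  simp [bracket]

theorem bracket_skew (x y : PositiveWitt k) : bracket k x y = -bracket k y x := by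
  have h : bracket k = -(bracket k).flip := by
    refine (e k).ext fun i => (e k).ext fun j => ?_
    rw [LinearMap.neg_apply, LinearMap.neg_apply, LinearMap.flip_apply, bracket_e, bracket_e,
      add_comm j i, ← neg_smul, neg_sub]
  simpa using LinearMap.congr_fun₂ h x y

@[elab_as_elim]
theorem spanInd {motive : PositiveWitt k → Prop} (x : PositiveWitt k)
    (e : ∀ i, motive (e k i)) (zero : motive 0)
    (add : ∀ x y, motive x → motive y → motive (x + y))
    (smul : ∀ (c : k) x, motive x → motive (c • x)) : motive x := by
  have hx : x ∈ Submodule.span k (Set.range (PositiveWitt.e k)) := by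
    rw [(PositiveWitt.e k).span_eq]; trivial
  induction hx using Submodule.span_induction with
  | mem x h =>
    obtain ⟨i, rfl⟩ := h
    exact e i
  | zero => exact zero
  | add x y _ _ hx hy => exact add x y hx hy
  | smul c x _ hx => exact smul c x hx

theorem bracket_self (x : PositiveWitt k) : bracket k x x = 0 := by
  induction x using spanInd k with
  | e i => simp [bracket_e]
  | zero => simp
  | add x y hx hy => simp [hx, hy, bracket_skew k y x]
  | smul c x hx => simp [hx]

theorem bracket_leibniz (x y z : PositiveWitt k) :
    bracket k x (bracket k y z) =
      bracket k (bracket k x y) z + bracket k y (bracket k x z) := by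
  have h : ∀ z i j, bracket k (e k i) (bracket k (e k j) z) =
      bracket k (bracket k (e k i) (e k j)) z + bracket k (e k j) (bracket k (e k i) z) := by
    intro z i j
    induction z using spanInd k with
    | e l =>
      simp only [bracket_e, map_smul, LinearMap.smul_apply, smul_smul]
      rw [add_left_comm j i l, add_assoc i j l, ← add_smul]
      congr 1
      push_cast
      ring
    | zero => simp
    | add x y hx hy => simp only [map_add, hx, hy]; abel
    | smul c x hx => simp only [map_smul, hx, smul_add]
  induction x using spanInd k with
  | zero => simp
  | add x x' hx hx' => simp only [map_add, LinearMap.add_apply, hx, hx']; abel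
  | smul c x hx => simp only [map_smul, LinearMap.smul_apply, hx, smul_add]
  | e i =>
    induction y using spanInd k with
    | zero => simp
    | add x x' hx hx' => simp only [map_add, LinearMap.add_apply, hx, hx']; abel
    | smul c x hx => simp only [map_smul, LinearMap.smul_apply, hx, smul_add]
    | e j => exact h z i j

instance : LieRing (PositiveWitt k) where
  bracket x y := bracket k x y
  add_lie x y z := by simp
  lie_add x y z := by simp
  lie_self x := bracket_self k x
  leibniz_lie x y z := bracket_leibniz k x y z

instance : LieAlgebra k (PositiveWitt k) where
  lie_smul t x y := (bracket k x).map_smul t y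

theorem lie_e (i j : ℕ+) :
    ⁅e k i, e k j⁆ = (((j : ℕ) : k) - ((i : ℕ) : k)) • e k (i + j) :=
  bracket_e k i j

end PositiveWitt

/-! ### Symmetric powers of a Lie algebra as modules over the enveloping algebra -/

namespace LieSymmetric

variable (k L : Type*) [CommRing k] [LieRing L] [LieAlgebra k L]

attribute [local instance] LieRing.ofAssociativeRing

/-- The algebra map `S(L) → S(L) ⊕ S(L)ε` with `y ↦ y + f(y) ε` for `y ∈ L`. -/
def dualLift (f : L →ₗ[k] L) :
    SymmetricAlgebra k L →ₐ[k]
      TrivSqZeroExt (SymmetricAlgebra k L) (SymmetricAlgebra k L) :=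
  SymmetricAlgebra.lift
    ((TrivSqZeroExt.inlAlgHom k _ _).toLinearMap ∘ₗ SymmetricAlgebra.ι k L +
      (TrivSqZeroExt.inrHom (SymmetricAlgebra k L) (SymmetricAlgebra k L)).restrictScalars k ∘ₗ
        SymmetricAlgebra.ι k L ∘ₗ f)

theorem fst_dualLift (f : L →ₗ[k] L) (a : SymmetricAlgebra k L) :
    (dualLift k L f a).fst = a := by
  have : (TrivSqZeroExt.fstHom k (SymmetricAlgebra k L) (SymmetricAlgebra k L)).comp
      (dualLift k L f) = AlgHom.id k _ := by
    apply SymmetricAlgebra.algHom_ext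
    ext y
    simp [dualLift]
  exact DFunLike.congr_fun this a

/-- The unique derivation of `S(L)` extending the linear map `f : L → L`. -/
def extendDer (f : L →ₗ[k] L) :
    Derivation k (SymmetricAlgebra k L) (SymmetricAlgebra k L) :=
  Derivation.mk'
    ((TrivSqZeroExt.sndHom (SymmetricAlgebra k L) (SymmetricAlgebra k L)).restrictScalars k ∘ₗ
      (dualLift k L f).toLinearMap)
    (fun a b => by simp [fst_dualLift, mul_comm])

theorem extendDer_ι (f : L →ₗ[k] L) (y : L) :
    extendDer k L f (SymmetricAlgebra.ι k L y) = SymmetricAlgebra.ι k L (f y) := by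
  simp [extendDer, dualLift]

theorem derivation_ext {D E : Derivation k (SymmetricAlgebra k L) (SymmetricAlgebra k L)}
    (h : ∀ y, D (SymmetricAlgebra.ι k L y) = E (SymmetricAlgebra.ι k L y)) : D = E := by
  ext a
  induction a using SymmetricAlgebra.induction with
  | algebraMap r => simp
  | ι x => exact h x
  | mul a b ha hb => simp [ha, hb]
  | add a b ha hb => simp [ha, hb]

/-- The action of `L` on `S(L)` by derivations that extends the adjoint action
(equivalently, `x` acts as the Poisson bracket `{x, -}`). -/
def adDer : L →ₗ⁅k⁆ Derivation k (SymmetricAlgebra k L) (SymmetricAlgebra k L) where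
  toFun x := extendDer k L (LieAlgebra.ad k L x)
  map_add' x y := derivation_ext k L fun z => by simp [extendDer_ι]
  map_smul' c x := derivation_ext k L fun z => by simp [extendDer_ι]
  map_lie' {x y} := derivation_ext k L fun z => by
    simp [extendDer_ι, Derivation.commutator_apply]

theorem adDer_ι (x y : L) :
    adDer k L x (SymmetricAlgebra.ι k L y) = SymmetricAlgebra.ι k L ⁅x, y⁆ := by
  simp [adDer, extendDer_ι]

/-- The homogeneous part `Sⁿ(L)` of the symmetric algebra `S(L)`, spanned by the products of `n`
elements of `L`. -/
def symPower (n : ℕ) : Submodule k (SymmetricAlgebra k L) :=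
  LinearMap.range (SymmetricAlgebra.ι k L) ^ n

theorem adDer_mem (n : ℕ) (x : L) {a : SymmetricAlgebra k L} (ha : a ∈ symPower k L n) :
    adDer k L x a ∈ symPower k L n := by
  induction n generalizing a with
  | zero =>
    rw [symPower, pow_zero, Submodule.mem_one] at ha
    obtain ⟨r, rfl⟩ := ha
    simp
  | succ n ih =>
    rw [symPower, pow_succ] at ha ⊢
    refine Submodule.mul_induction_on ha (fun b hb c hc => ?_) (fun b c hb hc => ?_)
    · rw [Derivation.leibniz, smul_eq_mul, smul_eq_mul, mul_comm c]
      refine add_mem (Submodule.mul_mem_mul hb ?_) (Submodule.mul_mem_mul (ih hb) hc)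
      obtain ⟨y, rfl⟩ := hc
      exact ⟨⁅x, y⁆, (adDer_ι k L x y).symm⟩
    · rw [map_add]
      exact add_mem hb hc

/-- `Sⁿ(L)` as a type of its own. -/
def SymPower (n : ℕ) : Type _ := symPower k L n

instance (n : ℕ) : AddCommGroup (SymPower k L n) :=
  inferInstanceAs (AddCommGroup (symPower k L n))

instance (n : ℕ) : Module k (SymPower k L n) :=
  inferInstanceAs (Module k (symPower k L n))

/-- The representation of `L` on `Sⁿ(L)`. -/
def symRep (n : ℕ) : L →ₗ⁅k⁆ Module.End k (SymPower k L n) where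
  toFun x := ((adDer k L x : SymmetricAlgebra k L →ₗ[k] SymmetricAlgebra k L).restrict
    fun _ ha => adDer_mem k L n x ha : symPower k L n →ₗ[k] symPower k L n)
  map_add' x y := LinearMap.ext fun a => Subtype.ext <| by
    change adDer k L (x + y) a.1 = adDer k L x a.1 + adDer k L y a.1
    simp
  map_smul' c x := LinearMap.ext fun a => Subtype.ext <| by
    change adDer k L (c • x) a.1 = c • adDer k L x a.1
    simp
  map_lie' {x y} := LinearMap.ext fun a => Subtype.ext <| by
    change adDer k L ⁅x, y⁆ a.1 =
      adDer k L x (adDer k L y a.1) - adDer k L y (adDer k L x a.1)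
    rw [LieHom.map_lie, Derivation.commutator_apply]

/-- `Sⁿ(L)` as a module over the universal enveloping algebra. -/
instance (n : ℕ) : Module (UniversalEnvelopingAlgebra k L) (SymPower k L n) :=
  Module.compHom (SymPower k L n)
    (UniversalEnvelopingAlgebra.lift k (symRep k L n)).toRingHom

theorem smul_def (n : ℕ) (u : UniversalEnvelopingAlgebra k L) (a : SymPower k L n) :
    u • a = UniversalEnvelopingAlgebra.lift k (symRep k L n) u a := rfl

instance (n : ℕ) :
    IsScalarTower k (UniversalEnvelopingAlgebra k L) (SymPower k L n) where
  smul_assoc c u a := by rw [smul_def, smul_def, map_smul, LinearMap.smul_apply]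

end LieSymmetric

/-! ### Gelfand–Kirillov dimension of modules -/

section GK

variable (k A M : Type*) [Field k] [Ring A] [Algebra k A] [AddCommGroup M] [Module k M]
  [Module A M] [IsScalarTower k A M]

/-- The Gelfand–Kirillov dimension of an `A`-module `M`: the supremum, over all
finite-dimensional subspaces `V ⊆ A` and `F ⊆ M`, of `limsup log_n dim ((k + V)ⁿ F)`, where
`(k + V)ⁿ = ∑_{i ≤ n} Vⁱ`. -/
def GKdim : EReal :=
  ⨆ (V : Submodule k A) (_ : V.FG) (F : Submodule k M) (_ : F.FG),
    Filter.limsup (fun n : ℕ =>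
      ((Real.logb n (Module.finrank k ((1 ⊔ V) ^ n • F : Submodule k M)) : ℝ) : EReal))
      Filter.atTop

/-- `M` is GK `d`-critical: it has GK-dimension `d` and each quotient by a nonzero submodule has
GK-dimension `< d`. -/
def IsGKCritical (d : EReal) : Prop :=
  GKdim k A M = d ∧ ∀ N : Submodule A M, N ≠ ⊥ → GKdim k A (M ⧸ N) < d

end GK

end

noncomputable section

/-! ### Bounds on GK-dimension from polynomial growth. -/

section GKBounds

open Filter Topology

/-! Give `e_a e_b` degree `a + b`. The space `degLE n` of elements of degree at most `n` has
dimension of order `n ^ 2`, and every element of the enveloping algebra raises degree by a bounded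
amount, so the GK-dimension of `S²(W₊)` is at most 2.

Everything else rests on one leading-term argument (`exists_mono_mem`). Fix `f ≠ 0`. In `e_i e_j f`,
either the two operators hit different factors of a monomial `e_p e_q`, giving `e_{p+i} e_{q+j}`, or
they hit the same factor, which leaves the other factor with its small index. Modulo monomials near
an axis, `e_i e_j` thus translates the exponents of `f` by `(i, j)`, with scalar weights. Order
exponents by degree, then by distance to the diagonal. Each monomial away from the axes and the
diagonal is the leading term of some `e_i e_j f`, and characteristic zero keeps its coefficient
nonzero. By induction, `degLE n` is contained in the span of the `e_i e_j f` with `i + j ≤ n` plus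
the span of `O(n)` boundary monomials.

Modulo a submodule containing `f`, only the `O(n)` boundary monomials survive, so the quotient has
GK-dimension at most 1; this gives the second claim and, as `1 < 2`, criticality. Conversely, `e₁`
and `e₂` generate `W₊`, and `e_i` is a polynomial of degree at most `i` in them, so `(k + V)ⁿ f`
with `V = ⟨e₁, e₂⟩` contains all those `e_i e_j f`. Its dimension is therefore at least that of
`degLE n` minus `O(n)`, which forces GK-dimension at least 2. -/

theorem tendsto_natCast_add_log_div_log (r : ℕ) (c : ℝ) :
    Tendsto (fun n : ℕ => (((r : ℝ) + Real.log c / Real.log n : ℝ) : EReal)) atTop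
      (𝓝 (r : EReal)) := by
  have h : Tendsto (fun n : ℕ => (r : ℝ) + Real.log c / Real.log n) atTop (𝓝 ((r : ℝ) + 0)) :=
    tendsto_const_nhds.add
      (tendsto_const_nhds.div_atTop (Real.tendsto_log_atTop.comp tendsto_natCast_atTop_atTop))
  rw [add_zero] at h
  exact (continuous_coe_real_ereal.tendsto _).comp h

theorem logb_mul_pow_eq {n : ℕ} (hn : 2 ≤ n) {c : ℝ} (hc : 0 < c) (r : ℕ) :
    Real.logb n (c * (n : ℝ) ^ r) = r + Real.log c / Real.log n := by
  have hn' : (1 : ℝ) < n := by exact_mod_cast hn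
  have hlog : Real.log n ≠ 0 := (Real.log_pos hn').ne'
  rw [Real.logb, Real.log_mul hc.ne' (by positivity), Real.log_pow]
  field_simp
  ring

variable {k A M : Type*} [Field k] [Ring A] [Algebra k A] [AddCommGroup M] [Module k M]
  [Module A M] [IsScalarTower k A M]

theorem fg_smul {V : Submodule k A} {F : Submodule k M} (hV : V.FG) (hF : F.FG) :
    (V • F).FG := by
  let S := Submodule.map₂ (Algebra.lsmul k k M : A →ₐ[k] _).toLinearMap V F
  have : Module.Finite k S := Module.Finite.iff_fg.2 (hV.map₂ _ hF)
  have hle : V • F ≤ S := Submodule.smul_le.2 fun v hv x hx =>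
    Submodule.apply_mem_map₂ (Algebra.lsmul k k M : A →ₐ[k] _).toLinearMap hv hx
  exact Module.Finite.iff_fg.1 (Submodule.finiteDimensional_of_le hle)

/-- A module with an exhaustive filtration of polynomial growth of degree `r`, on which every
element of `A` acts with bounded degree, has GK-dimension at most `r`. -/
theorem GKdim_le_of_filtration (Fil : ℕ → Submodule k M) (mono : Monotone Fil)
    (exhaust : ∀ x, ∃ n, x ∈ Fil n)
    (bdd : ∀ u : A, ∃ d, ∀ n, ∀ x ∈ Fil n, u • x ∈ Fil (n + d))
    (fin : ∀ n, Module.Finite k (Fil n)) (C r : ℕ)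
    (growth : ∀ n, Module.finrank k (Fil n) ≤ C * (n + 1) ^ r) :
    GKdim k A M ≤ r := by
  refine iSup_le fun V => iSup_le fun hV => iSup_le fun F => iSup_le fun hF => ?_
  obtain ⟨d, hd⟩ : ∃ d, ∀ n, V • Fil n ≤ Fil (n + d) := by
    induction V, hV using Submodule.fg_induction with
    | singleton u =>
      obtain ⟨d, hd⟩ := bdd u
      refine ⟨d, fun n => Submodule.smul_le.2 fun v hv x hx => ?_⟩
      obtain ⟨c, rfl⟩ := Submodule.mem_span_singleton.1 hv
      rw [smul_assoc]
      exact Submodule.smul_mem _ _ (hd n x hx)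
    | sup V₁ V₂ _ _ h₁ h₂ =>
      obtain ⟨d₁, h₁⟩ := h₁
      obtain ⟨d₂, h₂⟩ := h₂
      refine ⟨max d₁ d₂, fun n => ?_⟩
      rw [Submodule.sup_smul]
      exact sup_le ((h₁ n).trans (mono (by omega))) ((h₂ n).trans (mono (by omega)))
  obtain ⟨D, hD⟩ : ∃ D, F ≤ Fil D := by
    induction F, hF using Submodule.fg_induction with
    | singleton x =>
      obtain ⟨n, hn⟩ := exhaust x
      exact ⟨n, (Submodule.span_singleton_le_iff_mem _ _).2 hn⟩
    | sup F₁ F₂ _ _ h₁ h₂ =>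
      obtain ⟨d₁, h₁⟩ := h₁
      obtain ⟨d₂, h₂⟩ := h₂
      exact ⟨max d₁ d₂, sup_le (h₁.trans (mono (by omega))) (h₂.trans (mono (by omega)))⟩
  have hpow : ∀ m n, (1 ⊔ V) ^ m • Fil n ≤ Fil (n + m * d) := by
    intro m
    induction m with
    | zero => intro n; rw [pow_zero, Submodule.one_smul]; exact mono (by omega)
    | succ m ih =>
      intro n
      rw [pow_succ, ← smul_eq_mul, Submodule.smul_assoc]
      have h : (1 ⊔ V) • Fil n ≤ Fil (n + d) := by
        rw [Submodule.sup_smul, Submodule.one_smul]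
        exact sup_le (mono (by omega)) (hd n)
      refine (Submodule.smul_mono le_rfl h).trans ((ih _).trans (mono ?_))
      rw [add_mul]; omega
  -- The offset `D + 1` is absorbed into a multiple of `n`, hence `1 ≤ n`; using `C + 1` keeps the
  -- constant positive when `C = 0`, so that its logarithm is meaningful.
  have hdim : ∀ n : ℕ, 1 ≤ n → Module.finrank k ((1 ⊔ V) ^ n • F : Submodule k M) ≤
      ((C + 1) * (D + d + 1) ^ r) * n ^ r := by
    intro n hn
    have := fin (D + n * d)
    calc _ ≤ Module.finrank k (Fil (D + n * d)) :=
          Submodule.finrank_mono ((Submodule.smul_mono le_rfl hD).trans (hpow n D))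
      _ ≤ C * (D + n * d + 1) ^ r := growth _
      _ ≤ (C + 1) * ((D + d + 1) * n) ^ r := by
          gcongr
          · omega
          · nlinarith
      _ = _ := by rw [mul_pow, mul_assoc]
  set c : ℕ := (C + 1) * (D + d + 1) ^ r with hc
  have hc0 : 0 < c := by positivity
  rw [← (tendsto_natCast_add_log_div_log r c).limsup_eq]
  refine limsup_le_limsup (eventually_atTop.2 ⟨2, fun n hn => ?_⟩)
  rw [EReal.coe_le_coe_iff, ← logb_mul_pow_eq hn (by exact_mod_cast hc0)]
  have hn' : (1 : ℝ) < n := by exact_mod_cast hn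
  have hc1 : (1 : ℝ) ≤ c := by exact_mod_cast hc0
  -- A zero space contributes `logb n 0 = 0` by convention, so monotonicity of the logarithm does
  -- not apply to it.
  rcases Nat.eq_zero_or_pos (Module.finrank k ((1 ⊔ V) ^ n • F : Submodule k M)) with h0 | h0
  · rw [h0, Nat.cast_zero, Real.logb_zero]
    exact Real.logb_nonneg hn' (one_le_mul_of_one_le_of_one_le hc1 (one_le_pow₀ hn'.le))
  · exact Real.logb_le_logb_of_le hn' (by exact_mod_cast h0)
      (by exact_mod_cast hdim n (by omega))

theorem le_GKdim {V : Submodule k A} (hV : V.FG) {F : Submodule k M} (hF : F.FG) {c : ℝ}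
    (hc : 0 < c) (r : ℕ)
    (h : ∀ᶠ n : ℕ in atTop,
      c * (n : ℝ) ^ r ≤ Module.finrank k ((1 ⊔ V) ^ n • F : Submodule k M)) :
    (r : EReal) ≤ GKdim k A M := by
  refine le_trans ?_ (le_iSup₂_of_le V hV (le_iSup₂_of_le F hF le_rfl))
  rw [← (tendsto_natCast_add_log_div_log r c).limsup_eq]
  refine limsup_le_limsup ?_
  filter_upwards [h, eventually_ge_atTop 2] with n h hn
  rw [EReal.coe_le_coe_iff, ← logb_mul_pow_eq hn hc]
  have hn' : (1 : ℝ) < n := by exact_mod_cast hn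
  exact Real.logb_le_logb_of_le hn' (by positivity) h

end GKBounds

/-! ### Products in the symmetric square and induction on the enveloping algebra. -/

namespace LieSymmetric

variable {k L : Type*} [CommRing k] [LieRing L] [LieAlgebra k L]

variable (k) in
/-- The product `x y` as an element of `S²(L)`. -/
def prod (x y : L) : SymPower k L 2 :=
  ⟨SymmetricAlgebra.ι k L x * SymmetricAlgebra.ι k L y, by
    rw [symPower, pow_two]
    exact Submodule.mul_mem_mul ⟨x, rfl⟩ ⟨y, rfl⟩⟩

theorem prod_comm (x y : L) : prod k x y = prod k y x :=
  Subtype.ext (mul_comm _ _)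

variable (k L) in
/-- The product as a bilinear map `L × L → S²(L)`. -/
def prodHom : L →ₗ[k] L →ₗ[k] SymPower k L 2 :=
  LinearMap.mk₂ k (prod k)
    (fun x y z => Subtype.ext (by
      change _ = SymmetricAlgebra.ι k L x * _ + SymmetricAlgebra.ι k L y * _
      simp [prod, add_mul]))
    (fun c x y => Subtype.ext (by
      change _ = c • (SymmetricAlgebra.ι k L x * _)
      simp [prod]))
    (fun x y z => Subtype.ext (by
      change _ = SymmetricAlgebra.ι k L x * _ + SymmetricAlgebra.ι k L x * _
      simp [prod, mul_add]))
    (fun c x y => Subtype.ext (by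
      change _ = c • (SymmetricAlgebra.ι k L x * _)
      simp [prod]))

theorem prodHom_apply (x y : L) : prodHom k L x y = prod k x y := rfl

theorem ι_smul_prod (x y z : L) :
    UniversalEnvelopingAlgebra.ι k x • prod k y z = prod k ⁅x, y⁆ z + prod k y ⁅x, z⁆ := by
  rw [smul_def, UniversalEnvelopingAlgebra.lift_ι_apply]
  refine Subtype.ext ?_
  change adDer k L x (SymmetricAlgebra.ι k L y * SymmetricAlgebra.ι k L z) =
    SymmetricAlgebra.ι k L ⁅x, y⁆ * SymmetricAlgebra.ι k L z +
      SymmetricAlgebra.ι k L y * SymmetricAlgebra.ι k L ⁅x, z⁆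
  rw [Derivation.leibniz, adDer_ι, adDer_ι, smul_eq_mul, smul_eq_mul]
  ring

theorem span_prod_eq_top :
    Submodule.span k (Set.range fun p : L × L => prod k p.1 p.2) = ⊤ := by
  refine eq_top_iff.2 fun a _ => ?_
  obtain ⟨a, ha⟩ := a
  have ha' := ha
  rw [symPower, pow_two] at ha'
  let incl : SymPower k L 2 →ₗ[k] SymmetricAlgebra k L := (symPower k L 2).subtype
  suffices h : a ∈ (Submodule.span k (Set.range fun p : L × L => prod k p.1 p.2)).map incl by
    obtain ⟨b, hb, hba⟩ := h
    rwa [show b = ⟨a, ha⟩ from Subtype.ext hba] at hb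
  refine Submodule.mul_induction_on ha' ?_ fun b c hb hc => add_mem hb hc
  rintro _ ⟨x, rfl⟩ _ ⟨y, rfl⟩
  exact ⟨prod k x y, Submodule.subset_span ⟨(x, y), rfl⟩, rfl⟩

/-- The enveloping algebra is generated by the image of the Lie algebra. -/
theorem uea_induction {motive : UniversalEnvelopingAlgebra k L → Prop}
    (u : UniversalEnvelopingAlgebra k L)
    (algebraMap : ∀ c, motive (algebraMap k _ c))
    (ι : ∀ x, motive (UniversalEnvelopingAlgebra.ι k x))
    (add : ∀ u v, motive u → motive v → motive (u + v))
    (mul : ∀ u v, motive u → motive v → motive (u * v)) : motive u := by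
  obtain ⟨t, rfl⟩ : ∃ t, UniversalEnvelopingAlgebra.mkAlgHom k L t = u :=
    Quotient.mk_surjective u
  induction t using TensorAlgebra.induction with
  | algebraMap c => simpa using algebraMap c
  | ι x => exact ι x
  | mul a b ha hb => rw [map_mul]; exact mul _ _ ha hb
  | add a b ha hb => rw [map_add]; exact add _ _ ha hb

end LieSymmetric

/-! ### The monomial basis of the symmetric square. -/

namespace PositiveWitt

open LieSymmetric

variable (k : Type*) [Field k]

/-- The monomial `e_p e_q` in `S²(W₊)`. -/
def mono (p q : ℕ+) : SymPower k (PositiveWitt k) 2 := prod k (e k p) (e k q)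

/-- The basis element `e_n` in the enveloping algebra. -/
def eU (n : ℕ+) : UniversalEnvelopingAlgebra k (PositiveWitt k) :=
  UniversalEnvelopingAlgebra.ι k (e k n)

theorem mono_comm (p q : ℕ+) : mono k p q = mono k q p := prod_comm _ _

theorem eU_smul_mono (n p q : ℕ+) :
    eU k n • mono k p q = (((p : ℕ) : k) - ((n : ℕ) : k)) • mono k (p + n) q +
      (((q : ℕ) : k) - ((n : ℕ) : k)) • mono k p (q + n) := by
  rw [eU, mono, ι_smul_prod, lie_e, lie_e, ← prodHom_apply, ← prodHom_apply, map_smul, map_smul,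
    LinearMap.smul_apply, add_comm n p, add_comm n q]
  rfl

theorem span_mono_eq_top :
    Submodule.span k (Set.range fun p : ℕ+ × ℕ+ => mono k p.1 p.2) = ⊤ := by
  rw [eq_top_iff, ← span_prod_eq_top, Submodule.span_le]
  rintro _ ⟨⟨x, y⟩, rfl⟩
  change prodHom k _ x y ∈ _
  induction x using spanInd k with
  | zero => simp
  | add x x' h h' => rw [map_add, LinearMap.add_apply]; exact add_mem h h'
  | smul c x h => rw [map_smul, LinearMap.smul_apply]; exact Submodule.smul_mem _ c h
  | e i =>
    induction y using spanInd k with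
    | zero => simp
    | add x x' h h' => rw [map_add]; exact add_mem h h'
    | smul c x h => rw [map_smul]; exact Submodule.smul_mem _ c h
    | e j => exact Submodule.subset_span ⟨(i, j), rfl⟩

/-- The basis `e` identifies the symmetric algebra with a polynomial ring, where these become
distinct monomials: an unordered pair of indices has only one ordering with `p ≤ q`. -/
theorem linearIndependent_mono :
    LinearIndependent k fun p : {p : ℕ+ × ℕ+ // p.1 ≤ p.2} => mono k p.1.1 p.1.2 := by
  let φ : SymPower k (PositiveWitt k) 2 →ₗ[k] MvPolynomial ℕ+ k :=
    (SymmetricAlgebra.equivMvPolynomial (e k)).toLinearMap ∘ₗ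
      (symPower k (PositiveWitt k) 2).subtype
  refine LinearIndependent.of_comp φ ?_
  have hφ : ∀ p q, φ (mono k p q) =
      MvPolynomial.monomial (Finsupp.single p 1 + Finsupp.single q 1) 1 := by
    intro p q
    change SymmetricAlgebra.equivMvPolynomial (e k)
      (SymmetricAlgebra.ι k _ (e k p) * SymmetricAlgebra.ι k _ (e k q)) = _
    rw [map_mul, SymmetricAlgebra.equivMvPolynomial_ι_apply,
      SymmetricAlgebra.equivMvPolynomial_ι_apply, MvPolynomial.X, MvPolynomial.X,
      MvPolynomial.monomial_mul, one_mul]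
  have hinj : Function.Injective fun p : {p : ℕ+ × ℕ+ // p.1 ≤ p.2} =>
      (Finsupp.single p.1.1 1 + Finsupp.single p.1.2 1 : ℕ+ →₀ ℕ) := by
    rintro ⟨⟨a, b⟩, hab⟩ ⟨⟨c, d⟩, hcd⟩ h
    have h' := congrArg Finsupp.toMultiset h
    simp only [map_add, Finsupp.toMultiset_single, one_smul] at h'
    have h2 : a = c ∧ b = d ∨ a = d ∧ b = c := by
      have : ({a, b} : Multiset ℕ+) = {c, d} := h'
      simp only [Multiset.insert_eq_cons, Multiset.cons_eq_cons, Multiset.singleton_inj,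
        Multiset.singleton_eq_cons_iff] at this
      grind
    simp only at hab hcd
    rcases h2 with ⟨rfl, rfl⟩ | ⟨rfl, rfl⟩
    · rfl
    · obtain rfl := le_antisymm hab hcd; rfl
  have hfun : (φ ∘ fun p : {p : ℕ+ × ℕ+ // p.1 ≤ p.2} => mono k p.1.1 p.1.2) =
      MvPolynomial.basisMonomials ℕ+ k ∘ fun p : {p : ℕ+ × ℕ+ // p.1 ≤ p.2} =>
        (Finsupp.single p.1.1 1 + Finsupp.single p.1.2 1 : ℕ+ →₀ ℕ) := by
    funext p
    simp [hφ]
  rw [hfun]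
  exact (MvPolynomial.basisMonomials ℕ+ k).linearIndependent.comp _ hinj

end PositiveWitt

/-! ### Leading terms of `e_i e_j f`. -/

namespace PositiveWitt

open LieSymmetric

variable {k : Type*} [Field k]

theorem smul_comm_uea (c : k) (u : UniversalEnvelopingAlgebra k (PositiveWitt k))
    (x : SymPower k (PositiveWitt k) 2) : u • c • x = c • u • x := by
  rw [smul_def, smul_def, map_smul]

theorem eU_smul_eU_smul_mono (i j p q : ℕ+) :
    eU k i • eU k j • mono k p q =
      (((p : ℕ) - (j : ℕ) : k) * ((p : ℕ) + (j : ℕ) - (i : ℕ))) • mono k (p + j + i) q +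
      (((p : ℕ) - (j : ℕ) : k) * ((q : ℕ) - (i : ℕ))) • mono k (p + j) (q + i) +
      ((((q : ℕ) - (j : ℕ) : k) * ((p : ℕ) - (i : ℕ))) • mono k (p + i) (q + j) +
      (((q : ℕ) - (j : ℕ) : k) * ((q : ℕ) + (j : ℕ) - (i : ℕ))) • mono k p (q + j + i)) := by
  rw [eU_smul_mono k j, smul_add, smul_comm_uea, smul_comm_uea, eU_smul_mono, eU_smul_mono]
  simp only [smul_add, smul_smul, PNat.add_coe, Nat.cast_add]

/-- Every element of `S²(W₊)` is a combination of monomials with symmetric coefficients. -/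
theorem exists_symmetric_coeff [CharZero k] (f : SymPower k (PositiveWitt k) 2) :
    ∃ g : ℕ+ × ℕ+ →₀ k, (∀ p q, g (p, q) = g (q, p)) ∧
      Finsupp.linearCombination k (fun p : ℕ+ × ℕ+ => mono k p.1 p.2) g = f := by
  have hf : f ∈ Submodule.span k (Set.range fun p : ℕ+ × ℕ+ => mono k p.1 p.2) := by
    rw [span_mono_eq_top]; trivial
  obtain ⟨g, rfl⟩ := (Finsupp.mem_span_range_iff_exists_finsupp).1 hf
  refine ⟨(2⁻¹ : k) • (g + g.mapDomain Prod.swap), fun p q => ?_, ?_⟩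
  · have h : ∀ p q, g.mapDomain Prod.swap (p, q) = g (q, p) := fun p q =>
      Finsupp.mapDomain_apply Prod.swap_injective g (q, p)
    simp [h, add_comm]
  · rw [map_smul, map_add, Finsupp.linearCombination_mapDomain]
    have h : (fun p : ℕ+ × ℕ+ => mono k p.1 p.2) ∘ Prod.swap = fun p => mono k p.1 p.2 := by
      funext p
      exact mono_comm k _ _
    rw [h, ← two_smul k, smul_smul, inv_mul_cancel₀ two_ne_zero, one_smul]
    rfl

/-- Symmetry of `g` pairs off the four terms of the double Leibniz rule. The first sum collects the
cases where `e_i` and `e_j` hit different factors, the second those where they hit the same one;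
there the second index stays within the support of `g`. -/
theorem eU_smul_eU_smul_linearCombination (i j : ℕ+) (g : ℕ+ × ℕ+ →₀ k)
    (hg : ∀ p q, g (p, q) = g (q, p)) :
    eU k i • eU k j • Finsupp.linearCombination k (fun p : ℕ+ × ℕ+ => mono k p.1 p.2) g =
      ∑ p ∈ g.support, (2 * g p * (((p.1 : ℕ) - (i : ℕ)) * ((p.2 : ℕ) - (j : ℕ)))) •
        mono k (p.1 + i) (p.2 + j) +
      ∑ p ∈ g.support, (2 * g p *
        (((p.1 : ℕ) - (j : ℕ)) * ((p.1 : ℕ) + (j : ℕ) - (i : ℕ)))) • mono k (p.1 + j + i) p.2 := by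
  have hswap : ∀ φ : ℕ+ → ℕ+ → SymPower k (PositiveWitt k) 2,
      ∑ p ∈ g.support, g p • φ p.1 p.2 = ∑ p ∈ g.support, g p • φ p.2 p.1 := by
    intro φ
    refine Finset.sum_nbij' Prod.swap Prod.swap ?_ ?_ ?_ ?_ ?_
    · rintro ⟨p, q⟩ h
      simpa [hg q p] using h
    · rintro ⟨p, q⟩ h
      simpa [hg q p] using h
    · intros; rfl
    · intros; rfl
    · rintro ⟨p, q⟩ _
      simp [hg q p]
  have h₁ := hswap fun p q => (((p : ℕ) - (j : ℕ) : k) * ((q : ℕ) - (i : ℕ))) •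
    mono k (p + j) (q + i)
  have h₂ := hswap fun p q => (((q : ℕ) - (j : ℕ) : k) * ((q : ℕ) + (j : ℕ) - (i : ℕ))) •
    mono k p (q + j + i)
  simp only [Finsupp.linearCombination_apply, Finsupp.sum, Finset.smul_sum, smul_comm_uea,
    eU_smul_eU_smul_mono, smul_add, Finset.sum_add_distrib]
  rw [h₁, h₂, ← Finset.sum_add_distrib, ← Finset.sum_add_distrib, ← Finset.sum_add_distrib,
    ← Finset.sum_add_distrib]
  refine Finset.sum_congr rfl fun p _ => ?_
  rw [mono_comm k (p.2 + j), mono_comm k p.2]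
  module

/-- The monomials that need not be leading terms: those close to a coordinate axis or to the
diagonal. -/
def NearBoundary (K : ℕ) (a b : ℕ+) : Prop :=
  (a : ℕ) < K ∨ (b : ℕ) < K ∨ ((a : ℕ) < b + K ∧ (b : ℕ) < a + K)

variable (k) in
/-- The span of the exceptional monomials of degree at most `n`. -/
def boundarySpan (K n : ℕ) : Submodule k (SymPower k (PositiveWitt k) 2) :=
  Submodule.span k {x | ∃ a b : ℕ+, NearBoundary K a b ∧ (a + b : ℕ) ≤ n ∧ x = mono k a b}

/-- The span of the elements `e_i e_j f` with `i + j ≤ n`. -/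
def quadSpan (f : SymPower k (PositiveWitt k) 2) (n : ℕ) :
    Submodule k (SymPower k (PositiveWitt k) 2) :=
  Submodule.span k {x | ∃ i j : ℕ+, (i + j : ℕ) ≤ n ∧ x = eU k i • eU k j • f}

/-- Take the largest total degree, then the largest second coordinate. At equal degree this makes
the first coordinate smallest, so that after a translation far above the diagonal the competing
monomials lie closer to the diagonal. -/
theorem exists_leading_exponent {g : ℕ+ × ℕ+ →₀ k} (hg : g ≠ 0) :
    ∃ p ∈ g.support, ∀ q ∈ g.support, q ≠ p →
      (q.1 + q.2 : ℕ) < p.1 + p.2 ∨ (q.1 + q.2 : ℕ) = p.1 + p.2 ∧ (p.1 : ℕ) < q.1 := by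
  obtain ⟨p, hp, hmax⟩ := Finset.exists_max_image g.support
    (fun p => toLex ((p.1 + p.2 : ℕ), (p.2 : ℕ))) (Finsupp.support_nonempty_iff.2 hg)
  refine ⟨p, hp, fun q hq hqp => ?_⟩
  have h := hmax q hq
  rw [Prod.Lex.toLex_le_toLex] at h
  simp only at h
  rcases h with h | ⟨h, h'⟩
  · exact Or.inl h
  · refine Or.inr ⟨h, ?_⟩
    by_contra hlt
    apply hqp
    refine Prod.ext (PNat.eq ?_) (PNat.eq ?_) <;> omega

/-- Double induction, on the degree `s = a + b` and then on the gap `t = b - a`: away from the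
boundary, `e_a e_b` is the leading term of a suitable `e_i e_j f`, and every other term is a
boundary monomial, has smaller degree, or has the same degree and a smaller gap. -/
theorem exists_mono_mem [CharZero k] {f : SymPower k (PositiveWitt k) 2} (hf : f ≠ 0) :
    ∃ K : ℕ, ∀ (n : ℕ) (a b : ℕ+), (a + b : ℕ) ≤ n →
      mono k a b ∈ quadSpan f n ⊔ boundarySpan k K n := by
  obtain ⟨g, hsymm, rfl⟩ := exists_symmetric_coeff f
  have hg : g ≠ 0 := by
    rintro rfl
    simp at hf
  obtain ⟨⟨p₀, q₀⟩, hp₀, hlead⟩ := exists_leading_exponent hg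
  simp only at hlead
  set d : ℕ := p₀ + q₀ with hd
  set f := Finsupp.linearCombination k (fun p : ℕ+ × ℕ+ => mono k p.1 p.2) g with hfg
  have hdeg : ∀ p ∈ g.support, (p.1 + p.2 : ℕ) ≤ d := by
    intro p hp
    by_cases h : p = (p₀, q₀)
    · subst h; exact le_rfl
    · rcases hlead p hp h with h | h <;> omega
  -- Indices in the support of `g` are below `d`; a margin of `4 * d` makes `i`, `j` positive, keeps
  -- the weights nonzero and prevents same-degree terms from crossing the diagonal.
  refine ⟨4 * d, fun n => ?_⟩
  set T := quadSpan f n ⊔ boundarySpan k (4 * d) n with hT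
  have hbad : ∀ a b : ℕ+, NearBoundary (4 * d) a b → (a + b : ℕ) ≤ n → mono k a b ∈ T :=
    fun a b h hn => Submodule.mem_sup_right (Submodule.subset_span ⟨a, b, h, hn, rfl⟩)
  suffices key : ∀ s t : ℕ, ∀ a b : ℕ+, (a + b : ℕ) = s → (a : ℕ) ≤ b → (b : ℕ) = a + t →
      s ≤ n → mono k a b ∈ T by
    intro a b hn
    rcases le_total (a : ℕ) b with h | h
    · exact key _ (b - a) a b rfl h (by omega) hn
    · rw [mono_comm]
      exact key _ (a - b) b a rfl h (by omega) (by omega)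
  intro s
  induction s using Nat.strong_induction_on with
  | _ s ihs =>
  intro t
  induction t using Nat.strong_induction_on with
  | _ t iht =>
  intro a b hs hab ht hn
  by_cases hB : NearBoundary (4 * d) a b
  · exact hbad a b hB (by omega)
  simp only [NearBoundary, not_or, not_and, not_lt] at hB
  obtain ⟨ha, hb, hgap⟩ := hB
  have hgap : (a : ℕ) + 4 * d ≤ b := by
    by_contra h
    have := hgap (by have := p₀.pos; have := q₀.pos; omega)
    omega
  have hp₀pos := p₀.pos
  have hq₀pos := q₀.pos
  -- The translation by `(i, j)` carries the leading exponent `(p₀, q₀)` to `(a, b)`.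
  let i : ℕ+ := ⟨a - p₀, by omega⟩
  let j : ℕ+ := ⟨b - q₀, by omega⟩
  have hi : (i : ℕ) = a - p₀ := rfl
  have hj : (j : ℕ) = b - q₀ := rfl
  have hx : eU k i • eU k j • f ∈ T :=
    Submodule.mem_sup_left (Submodule.subset_span ⟨i, j, by omega, rfl⟩)
  rw [hfg, eU_smul_eU_smul_linearCombination i j g hsymm, ← Finset.add_sum_erase _ _ hp₀] at hx
  have hedge : ∀ p ∈ g.support, mono k (p.1 + j + i) p.2 ∈ T := by
    intro p hp
    have := hdeg p hp
    have := p.1.pos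
    have := p.2.pos
    refine hbad _ _ (Or.inr (Or.inl (by omega))) ?_
    simp only [PNat.add_coe]
    omega
  have hother : ∀ p ∈ g.support.erase (p₀, q₀), mono k (p.1 + i) (p.2 + j) ∈ T := by
    intro p hp
    obtain ⟨hne, hp⟩ := Finset.mem_erase.1 hp
    have hsum : ((p.1 + i : ℕ+) + (p.2 + j : ℕ+) : ℕ) = p.1 + p.2 + (i + j) := by
      simp only [PNat.add_coe]; omega
    rcases hlead p hp hne with h | ⟨h, h'⟩
    · rcases le_total ((p.1 + i : ℕ+) : ℕ) (p.2 + j : ℕ+) with hle | hle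
      · exact ihs _ (by omega) _ _ _ hsum hle (Nat.add_sub_cancel' hle).symm (by omega)
      · rw [mono_comm]
        exact ihs _ (by omega) _ _ _ ((add_comm _ _).trans hsum) hle
          (Nat.add_sub_cancel' hle).symm (by omega)
    -- The gap drops by `2 * (p.1 - p₀)`, which is positive and less than `2 * d`, hence smaller
    -- than the original gap.
    · have hle : ((p.1 + i : ℕ+) : ℕ) ≤ (p.2 + j : ℕ+) := by
        simp only [PNat.add_coe]; omega
      refine iht (((p.2 + j : ℕ+) : ℕ) - (p.1 + i : ℕ+)) ?_ _ _ (by omega) hle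
        (Nat.add_sub_cancel' hle).symm hn
      simp only [PNat.add_coe] at hle ⊢
      omega
  rw [add_assoc] at hx
  have hmem := (Submodule.add_mem_iff_left T (add_mem
    (Submodule.sum_mem T fun p hp => Submodule.smul_mem T _ (hother p hp))
    (Submodule.sum_mem T fun p hp => Submodule.smul_mem T _ (hedge p hp)))).1 hx
  have hai : p₀ + i = a := PNat.eq (by rw [PNat.add_coe]; omega)
  have hbj : q₀ + j = b := PNat.eq (by rw [PNat.add_coe]; omega)
  simp only [hai, hbj] at hmem
  refine (Submodule.smul_mem_iff T ?_).1 hmem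
  -- The weights vanish only if `a = 2 * p₀` or `b = 2 * q₀`, impossible since `a` and `b` are at
  -- least `4 * d`.
  refine mul_ne_zero (mul_ne_zero two_ne_zero (Finsupp.mem_support_iff.1 hp₀))
    (mul_ne_zero (sub_ne_zero.2 ?_) (sub_ne_zero.2 ?_)) <;>
  · rw [Ne, Nat.cast_inj]
    omega

end PositiveWitt

/-! ### The degree filtration and dimension counts. -/

namespace PositiveWitt

open LieSymmetric

variable (k : Type*) [Field k]

/-- The elements of `S²(W₊)` of degree at most `n`, where `e_a e_b` has degree `a + b`. -/
def degLE (n : ℕ) : Submodule k (SymPower k (PositiveWitt k) 2) :=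
  Submodule.span k {x | ∃ a b : ℕ+, (a + b : ℕ) ≤ n ∧ x = mono k a b}

variable {k}

theorem mono_mem_degLE {a b : ℕ+} {n : ℕ} (h : (a + b : ℕ) ≤ n) : mono k a b ∈ degLE k n :=
  Submodule.subset_span ⟨a, b, h, rfl⟩

theorem degLE_mono : Monotone (degLE k) := by
  intro m n hmn
  refine Submodule.span_mono ?_
  rintro _ ⟨a, b, h, rfl⟩
  exact ⟨a, b, h.trans hmn, rfl⟩

theorem exists_mem_degLE (x : SymPower k (PositiveWitt k) 2) : ∃ n, x ∈ degLE k n := by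
  have hx : x ∈ Submodule.span k (Set.range fun p : ℕ+ × ℕ+ => mono k p.1 p.2) := by
    rw [span_mono_eq_top]; trivial
  induction hx using Submodule.span_induction with
  | mem x h =>
    obtain ⟨p, rfl⟩ := h
    exact ⟨_, mono_mem_degLE le_rfl⟩
  | zero => exact ⟨0, zero_mem _⟩
  | add x y _ _ hx hy =>
    obtain ⟨m, hm⟩ := hx
    obtain ⟨n, hn⟩ := hy
    exact ⟨max m n, add_mem (degLE_mono (le_max_left _ _) hm) (degLE_mono (le_max_right _ _) hn)⟩
  | smul c x _ hx =>
    obtain ⟨n, hn⟩ := hx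
    exact ⟨n, Submodule.smul_mem _ c hn⟩

theorem eU_smul_mem_degLE (i : ℕ+) {n : ℕ} {x : SymPower k (PositiveWitt k) 2}
    (hx : x ∈ degLE k n) : eU k i • x ∈ degLE k (n + i) := by
  induction hx using Submodule.span_induction with
  | mem x h =>
    obtain ⟨a, b, h, rfl⟩ := h
    rw [eU_smul_mono]
    refine add_mem (Submodule.smul_mem _ _ (mono_mem_degLE ?_))
      (Submodule.smul_mem _ _ (mono_mem_degLE ?_)) <;>
    · rw [PNat.add_coe]
      omega
  | zero => rw [smul_zero]; exact zero_mem _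
  | add x y _ _ hx hy => rw [smul_add]; exact add_mem hx hy
  | smul c x _ hx => rw [smul_comm_uea]; exact Submodule.smul_mem _ c hx

theorem exists_smul_mem_degLE (u : UniversalEnvelopingAlgebra k (PositiveWitt k)) :
    ∃ d, ∀ n, ∀ x ∈ degLE k n, u • x ∈ degLE k (n + d) := by
  induction u using uea_induction with
  | algebraMap c =>
    refine ⟨0, fun n x hx => ?_⟩
    rw [algebraMap_smul]
    exact Submodule.smul_mem _ c hx
  | ι y =>
    induction y using spanInd k with
    | e i => exact ⟨i, fun n x hx => eU_smul_mem_degLE i hx⟩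
    | zero => exact ⟨0, fun n x _ => by rw [map_zero, zero_smul]; exact zero_mem _⟩
    | add y z hy hz =>
      obtain ⟨d₁, h₁⟩ := hy
      obtain ⟨d₂, h₂⟩ := hz
      refine ⟨max d₁ d₂, fun n x hx => ?_⟩
      rw [map_add, add_smul]
      exact add_mem (degLE_mono (by omega) (h₁ n x hx)) (degLE_mono (by omega) (h₂ n x hx))
    | smul c y hy =>
      obtain ⟨d, h⟩ := hy
      refine ⟨d, fun n x hx => ?_⟩
      rw [map_smul, smul_assoc]
      exact Submodule.smul_mem _ c (h n x hx)
  | add u v hu hv =>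
    obtain ⟨d₁, h₁⟩ := hu
    obtain ⟨d₂, h₂⟩ := hv
    refine ⟨max d₁ d₂, fun n x hx => ?_⟩
    rw [add_smul]
    exact add_mem (degLE_mono (by omega) (h₁ n x hx)) (degLE_mono (by omega) (h₂ n x hx))
  | mul u v hu hv =>
    obtain ⟨d₁, h₁⟩ := hu
    obtain ⟨d₂, h₂⟩ := hv
    refine ⟨d₂ + d₁, fun n x hx => ?_⟩
    rw [mul_smul, ← add_assoc]
    exact h₁ _ _ (h₂ n x hx)

/-- A subspace spanned by monomials with exponents in a finite set `S` has dimension at most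
`#S`. -/
theorem finite_and_finrank_span_mono_le (S : Finset (ℕ × ℕ))
    {X : Set (SymPower k (PositiveWitt k) 2)}
    (hX : ∀ x ∈ X, ∃ a b : ℕ+, ((a : ℕ), (b : ℕ)) ∈ S ∧ x = mono k a b) :
    Module.Finite k (Submodule.span k X) ∧
      Module.finrank k (Submodule.span k X) ≤ S.card := by
  classical
  -- The junk value of `toPNat'` at `0` is harmless: `T` need only contain `X`, whose exponents are
  -- positive.
  let T : Finset (SymPower k (PositiveWitt k) 2) :=
    S.image fun p => mono k p.1.toPNat' p.2.toPNat'
  have hXT : X ⊆ T := by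
    intro x hx
    obtain ⟨a, b, hab, rfl⟩ := hX x hx
    refine Finset.mem_coe.2 (Finset.mem_image.2 ⟨_, hab, ?_⟩)
    simp
  have hfin : Module.Finite k (Submodule.span k (T : Set (SymPower k (PositiveWitt k) 2))) :=
    FiniteDimensional.span_finset k T
  exact ⟨Submodule.finiteDimensional_of_le (Submodule.span_mono hXT),
    (Submodule.finrank_mono (Submodule.span_mono hXT)).trans
      ((finrank_span_finset_le_card T).trans Finset.card_image_le)⟩

theorem finite_and_finrank_degLE_le (n : ℕ) :
    Module.Finite k (degLE k n) ∧ Module.finrank k (degLE k n) ≤ (n + 1) ^ 2 := by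
  have h := finite_and_finrank_span_mono_le (k := k)
    (Finset.range (n + 1) ×ˢ Finset.range (n + 1))
    (X := {x | ∃ a b : ℕ+, (a + b : ℕ) ≤ n ∧ x = mono k a b}) (by
      rintro _ ⟨a, b, h, rfl⟩
      refine ⟨a, b, ?_, rfl⟩
      simp only [Finset.mem_product, Finset.mem_range]
      omega)
  rwa [Finset.card_product, Finset.card_range, ← pow_two] at h

/-- The exceptional exponents lie in four strips of width `K` and length `n + 1`: one along each
axis and one on each side of the diagonal. Growth is therefore linear in `n`. -/
theorem finite_and_finrank_boundarySpan_le (K n : ℕ) :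
    Module.Finite k (boundarySpan k K n) ∧
      Module.finrank k (boundarySpan k K n) ≤ 4 * K * (n + 1) := by
  classical
  let R := Finset.range (n + 1) ×ˢ Finset.range K
  have hR : R.card = (n + 1) * K := by
    rw [Finset.card_product, Finset.card_range, Finset.card_range]
  let S : Finset (ℕ × ℕ) := (R.image Prod.swap ∪ R) ∪
    ((R.image fun p => (p.1, p.1 + p.2)) ∪ R.image fun p => (p.1 + p.2, p.1))
  have hS : S.card ≤ 4 * K * (n + 1) := by
    have h₁ : (R.image Prod.swap).card ≤ R.card := Finset.card_image_le
    have h₂ : (R.image fun p => (p.1, p.1 + p.2)).card ≤ R.card := Finset.card_image_le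
    have h₃ : (R.image fun p => (p.1 + p.2, p.1)).card ≤ R.card := Finset.card_image_le
    have h₄ := Finset.card_union_le (R.image Prod.swap) R
    have h₅ := Finset.card_union_le (R.image fun p => (p.1, p.1 + p.2))
      (R.image fun p => (p.1 + p.2, p.1))
    have h₆ : S.card ≤ _ := Finset.card_union_le _ _
    have h₇ : 4 * K * (n + 1) = 4 * R.card := by rw [hR]; ring
    omega
  have h := finite_and_finrank_span_mono_le (k := k) S
    (X := {x | ∃ a b : ℕ+, NearBoundary K a b ∧ (a + b : ℕ) ≤ n ∧ x = mono k a b}) (by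
      rintro _ ⟨a, b, hK, h, rfl⟩
      refine ⟨a, b, ?_, rfl⟩
      simp only [S, R, Finset.mem_union, Finset.mem_image, Finset.mem_product, Finset.mem_range,
        Prod.exists, Prod.mk.injEq, Prod.swap_prod_mk]
      rcases hK with hK | hK | hK
      · exact Or.inl (Or.inl ⟨b, a, by omega, rfl, rfl⟩)
      · exact Or.inl (Or.inr (by omega))
      · rcases le_total (a : ℕ) b with hab | hab
        · exact Or.inr (Or.inl ⟨a, b - a, by omega, rfl, by omega⟩)
        · exact Or.inr (Or.inr ⟨b, a - b, by omega, by omega, rfl⟩))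
  exact ⟨h.1, h.2.trans hS⟩

/-! ### Upper bounds on GK-dimension. -/

theorem degLE_le_sup [CharZero k] {f : SymPower k (PositiveWitt k) 2} (hf : f ≠ 0) :
    ∃ K : ℕ, ∀ n, degLE k n ≤ quadSpan f n ⊔ boundarySpan k K n := by
  obtain ⟨K, hK⟩ := exists_mono_mem hf
  refine ⟨K, fun n => Submodule.span_le.2 ?_⟩
  rintro _ ⟨a, b, h, rfl⟩
  exact hK n a b h

theorem GKdim_quotient_le_one [CharZero k]
    (N : Submodule (UniversalEnvelopingAlgebra k (PositiveWitt k)) (SymPower k (PositiveWitt k) 2))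
    {f : SymPower k (PositiveWitt k) 2} (hfN : f ∈ N) (hf : f ≠ 0) :
    GKdim k (UniversalEnvelopingAlgebra k (PositiveWitt k))
      (SymPower k (PositiveWitt k) 2 ⧸ N) ≤ 1 := by
  obtain ⟨K, hK⟩ := degLE_le_sup hf
  let π : SymPower k (PositiveWitt k) 2 →ₗ[k] SymPower k (PositiveWitt k) 2 ⧸ N :=
    N.mkQ.restrictScalars k
  -- The elements `e_i e_j f` die in the quotient, so the boundary monomials alone span the image of
  -- each filtration step.
  have hle : ∀ n, (degLE k n).map π ≤ (boundarySpan k K n).map π := by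
    intro n
    refine (Submodule.map_mono (hK n)).trans ?_
    rw [Submodule.map_sup]
    refine sup_le ?_ le_rfl
    rw [quadSpan, Submodule.map_span_le]
    rintro _ ⟨i, j, _, rfl⟩
    have h0 : π (eU k i • eU k j • f) = 0 :=
      (Submodule.Quotient.mk_eq_zero N).2 (N.smul_mem _ (N.smul_mem _ hfN))
    rw [h0]
    exact zero_mem _
  have hfin : ∀ n, Module.Finite k ((boundarySpan k K n).map π) := fun n =>
    have := (finite_and_finrank_boundarySpan_le (k := k) K n).1
    inferInstance
  have key := GKdim_le_of_filtration (A := UniversalEnvelopingAlgebra k (PositiveWitt k))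
    (fun n => (degLE k n).map π) (fun m n h => Submodule.map_mono (degLE_mono h))
    (fun x => by
      obtain ⟨y, rfl⟩ := N.mkQ_surjective x
      obtain ⟨n, hn⟩ := exists_mem_degLE y
      exact ⟨n, y, hn, rfl⟩)
    (fun u => by
      obtain ⟨d, hd⟩ := exists_smul_mem_degLE u
      refine ⟨d, ?_⟩
      rintro n _ ⟨x, hx, rfl⟩
      exact ⟨u • x, hd n x hx, rfl⟩)
    (fun n => have := hfin n; Submodule.finiteDimensional_of_le (hle n))
    (4 * K) 1
    (fun n => by
      have := hfin n
      have hb := finite_and_finrank_boundarySpan_le (k := k) K n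
      have := hb.1
      rw [pow_one]
      exact (Submodule.finrank_mono (hle n)).trans ((Submodule.finrank_map_le _ _).trans hb.2))
  simpa using key

theorem GKdim_symPower_two_le :
    GKdim k (UniversalEnvelopingAlgebra k (PositiveWitt k)) (SymPower k (PositiveWitt k) 2)
      ≤ 2 := by
  have key := GKdim_le_of_filtration (A := UniversalEnvelopingAlgebra k (PositiveWitt k))
    (degLE k) degLE_mono exists_mem_degLE exists_smul_mem_degLE
    (fun n => (finite_and_finrank_degLE_le n).1) 1 2
    (fun n => by rw [one_mul]; exact (finite_and_finrank_degLE_le n).2)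
  simpa using key

-- The generators `e₁`, `e₂` and the lower bound on GK-dimension.

attribute [local instance 100] LieRing.ofAssociativeRing

variable (k) in
/-- The span of the generators `e₁, e₂` of `W₊`. -/
def genSpan : Submodule k (UniversalEnvelopingAlgebra k (PositiveWitt k)) :=
  Submodule.span k {eU k 1, eU k 2}

theorem eU_mul_sub_mul (i j : ℕ+) :
    eU k i * eU k j - eU k j * eU k i = (((j : ℕ) : k) - ((i : ℕ) : k)) • eU k (i + j) := by
  have h := LieHom.map_lie (UniversalEnvelopingAlgebra.ι k) (e k i) (e k j)
  rw [lie_e, map_smul, LieRing.of_associative_ring_bracket] at h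
  exact h.symm

/-- Since `[e₁, e_i] = (i - 1) e_{i+1}`, each further index costs one more factor `e₁`. -/
theorem eU_mem_pow [CharZero k] (i : ℕ+) : eU k i ∈ (1 ⊔ genSpan k) ^ (i : ℕ) := by
  have hgen : ∀ i : ℕ+, i = 1 ∨ i = 2 → eU k i ∈ 1 ⊔ genSpan k := by
    intro i hi
    refine Submodule.mem_sup_right (Submodule.subset_span ?_)
    rcases hi with rfl | rfl <;> simp
  induction i using PNat.recOn with
  | one =>
    rw [PNat.one_coe, pow_one]
    exact hgen _ (Or.inl rfl)
  | succ i ih =>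
    -- At `i = 1` the bracket vanishes, which is why `e₂` is needed as a second generator.
    by_cases hi : i = 1
    · subst hi
      refine pow_le_pow_right₀ (le_sup_left : 1 ≤ 1 ⊔ genSpan k)
        (by simp : 1 ≤ ((1 + 1 : ℕ+) : ℕ)) ?_
      rw [pow_one]
      exact hgen _ (Or.inr rfl)
    · have hne : ((i : ℕ) : k) - ((1 : ℕ+) : ℕ) ≠ 0 := by
        rw [sub_ne_zero, Ne, Nat.cast_inj, PNat.coe_inj]
        exact hi
      refine (Submodule.smul_mem_iff _ hne).1 ?_
      rw [add_comm i 1, ← eU_mul_sub_mul, add_comm 1 i, PNat.add_coe, PNat.one_coe]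
      refine sub_mem ?_ ?_
      · rw [pow_succ']
        exact Submodule.mul_mem_mul (hgen _ (Or.inl rfl)) ih
      · rw [pow_succ]
        exact Submodule.mul_mem_mul ih (hgen _ (Or.inl rfl))

theorem quadSpan_le [CharZero k] (f : SymPower k (PositiveWitt k) 2) (n : ℕ) :
    quadSpan f n ≤ (1 ⊔ genSpan k) ^ n • Submodule.span k {f} := by
  refine Submodule.span_le.2 ?_
  rintro _ ⟨i, j, h, rfl⟩
  rw [SetLike.mem_coe, ← mul_smul]
  refine Submodule.smul_mem_smul
    (pow_le_pow_right₀ (le_sup_left : 1 ≤ 1 ⊔ genSpan k) h ?_) (Submodule.mem_span_singleton_self f)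
  rw [pow_add]
  exact Submodule.mul_mem_mul (eU_mem_pow i) (eU_mem_pow j)

/-- The `m ^ 2` monomials with first index in `[1, m]` and second in `[m + 1, 2m]` are independent
and have degree at most `3 * m`. -/
theorem sq_le_finrank_degLE (m n : ℕ) (h : 3 * m ≤ n) :
    m ^ 2 ≤ Module.finrank k (degLE k n) := by
  have := (finite_and_finrank_degLE_le (k := k) n).1
  let φ : Fin m × Fin m → {p : ℕ+ × ℕ+ // p.1 ≤ p.2} := fun x =>
    ⟨(⟨x.1 + 1, by omega⟩, ⟨m + x.2 + 1, by omega⟩), by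
      rw [← PNat.coe_le_coe, PNat.mk_coe, PNat.mk_coe]
      omega⟩
  have hφ : Function.Injective φ := by
    rintro ⟨a, b⟩ ⟨c, d⟩ h
    have h1 := congrArg (fun p : {p : ℕ+ × ℕ+ // p.1 ≤ p.2} => (p.1.1 : ℕ)) h
    have h2 := congrArg (fun p : {p : ℕ+ × ℕ+ // p.1 ≤ p.2} => (p.1.2 : ℕ)) h
    simp only [φ, PNat.mk_coe] at h1 h2
    refine Prod.ext (Fin.ext ?_) (Fin.ext ?_) <;> simp only <;> omega
  have hli := (linearIndependent_mono k).comp φ hφ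
  have hcard := finrank_span_eq_card hli
  rw [Fintype.card_prod, Fintype.card_fin, ← pow_two] at hcard
  rw [← hcard]
  refine Submodule.finrank_mono (Submodule.span_le.2 ?_)
  rintro _ ⟨x, rfl⟩
  refine mono_mem_degLE ?_
  simp only [φ, PNat.mk_coe]
  omega

/-- The single vector `e₁ ^ 2` already generates quadratic growth: its orbit under `e₁`, `e₂` fills
`degLE n` up to a linear error. -/
theorem two_le_GKdim_symPower_two [CharZero k] :
    2 ≤ GKdim k (UniversalEnvelopingAlgebra k (PositiveWitt k))
      (SymPower k (PositiveWitt k) 2) := by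
  have hf : mono k 1 1 ≠ 0 := 
    (linearIndependent_mono k).ne_zero (⟨(1, 1), le_rfl⟩ : {p : ℕ+ × ℕ+ // p.1 ≤ p.2})
  obtain ⟨K, hK⟩ := degLE_le_sup hf
  have hV : (genSpan k).FG := Submodule.fg_span (Set.toFinite _)
  have hF : (Submodule.span k {mono k 1 1}).FG := Submodule.fg_span (Set.finite_singleton _)
  -- The main term is about `n ^ 2 / 9`; for `n ≥ 1000 * (K + 1)` the error `4 * K * (n + 1)` is a
  -- small fraction of `n ^ 2`, leaving ample room above `n ^ 2 / 20`.
  have key := le_GKdim hV hF (c := 1 / 20) (by norm_num) 2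
    (Filter.eventually_atTop.2 ⟨1000 * (K + 1), fun n hn => ?_⟩)
  · simpa using key
  set W := (1 ⊔ genSpan k) ^ n • Submodule.span k {mono k 1 1} with hW
  have hWfin : Module.Finite k W := by
    have hone : (1 : Submodule k (UniversalEnvelopingAlgebra k (PositiveWitt k))).FG := by
      rw [Submodule.one_eq_span]
      exact Submodule.fg_span (Set.finite_singleton _)
    exact Module.Finite.iff_fg.2 (fg_smul ((hone.sup hV).pow n) hF)
  have hB := finite_and_finrank_boundarySpan_le (k := k) K n
  have := hB.1
  have h₁ : Module.finrank k (degLE k n) ≤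
      Module.finrank k (W ⊔ boundarySpan k K n : Submodule k _) :=
    Submodule.finrank_mono ((hK n).trans (sup_le_sup_right (quadSpan_le _ n) _))
  have h₂ := Submodule.finrank_add_le_finrank_add_finrank W (boundarySpan k K n)
  have h₃ := sq_le_finrank_degLE (k := k) (n / 3) n (by omega)
  have h₄ : (n / 3) ^ 2 ≤ Module.finrank k W + 4 * K * (n + 1) := by
    have := hB.2
    omega
  have h₅ : n ≤ 3 * (n / 3) + 2 := by omega
  generalize n / 3 = m at h₄ h₅
  generalize Module.finrank k W = w at h₄
  have h₄' : (m : ℝ) ^ 2 ≤ w + 4 * K * (n + 1) := by exact_mod_cast h₄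
  have h₅' : (n : ℝ) ≤ 3 * m + 2 := by exact_mod_cast h₅
  have hn' : 1000 * ((K : ℝ) + 1) ≤ n := by exact_mod_cast hn
  have hK0 : (0 : ℝ) ≤ K := Nat.cast_nonneg K
  have h₆ : ((n : ℝ) - 2) ^ 2 ≤ (3 * m) ^ 2 := by
    apply pow_le_pow_left₀ <;> linarith
  have h₇ : 1000 * ((K : ℝ) + 1) * n ≤ n * n := by
    apply mul_le_mul_of_nonneg_right hn'; positivity
  nlinarith [mul_nonneg hK0 (Nat.cast_nonneg (α := ℝ) n)]

end PositiveWitt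

end

theorem corollary4p10 (k : Type*) [Field k] [CharZero k] :
    IsGKCritical k (UniversalEnvelopingAlgebra k (PositiveWitt k))
      (LieSymmetric.SymPower k (PositiveWitt k) 2) 2 ∧
    ∀ f : LieSymmetric.SymPower k (PositiveWitt k) 2, f ≠ 0 →
      GKdim k (UniversalEnvelopingAlgebra k (PositiveWitt k))
        (LieSymmetric.SymPower k (PositiveWitt k) 2 ⧸
          Submodule.span (UniversalEnvelopingAlgebra k (PositiveWitt k)) {f}) ≤ 1 := by
  refine ⟨⟨le_antisymm PositiveWitt.GKdim_symPower_two_le PositiveWitt.two_le_GKdim_symPower_two,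
    fun N hN => ?_⟩, fun f hf => ?_⟩
  · obtain ⟨f, hfN, hf⟩ := N.ne_bot_iff.1 hN
    refine (PositiveWitt.GKdim_quotient_le_one N hfN hf).trans_lt ?_
    exact_mod_cast (one_lt_two : (1 : ℝ) < 2)
  · exact PositiveWitt.GKdim_quotient_le_one _ (Submodule.mem_span_singleton_self f) hf
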